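/- **Setting.** Let $\mathcal A=\{1,\dots,d\}$ be the base arms and $\mathcal M\subseteq 2^{\mathcal A}$ a family of super arms with $|M|\le m$ for all $M\in\mathcal M$ and $\bigcup\mathcal M=\mathcal A$. Let $\nu$ be a probability distribution on $[0,1]^d$ with mean $\mu$, and let $w_1,w_2,\dots\sim\nu$ be i.i.d. Put $f(M,x)=\sum_{e\in M}x(e)$. Let $M^*\in\mathcal M$ maximize $f(\cdot,\mu)$, put $\Delta_M=f(M^*,\mu)-f(M,\mu)$ and $$\Delta_{e,\min}=f(M^*,\mu)-\max\{f(M,\mu):M\in\mathcal M,\ e\in M,\ \Delta_M>0\},$$ and let $\tilde{\mathcal A}$ be the set of the items $e\notin M^*$ that lie in some $M\in\mathcal M$ with $\Delta_M>0$ (all items outside $M^*$, if $M^*$ is the unique optimal super arm). The regret is $\mathcal R_\nu(n,\pi)=\sum_{t=1}^n\big(\mathbb E f(M^*,w_t)-\mathbb E f(M(t),w_t)\big)$, where $M(t)$ is the super arm played in round $t$; after playing $M(t)$ the learner observes $w_t(e)$ for $e\in M(t)$. An oracle returns, for each $u\in\mathbb R^d$, a maximizer of $f(\cdot,u)$ over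 $\mathcal M$ (ties broken by any fixed measurable rule). **Algorithm MixCombUCB** (parameters $\alpha\ge 0$ and $\kappa\ge1$). *Initialization:* start with $u=(1,\dots,1)$; while $u\ne0$, play the oracle's $M(t)\in\arg\max_{M\in\mathcal M} f(M,u)$, and for each $e\in M(t)$ set $\hat w(e)=w_t(e)$, $u(e)=0$, $M_e=M(t)$. Let $E$ be the set of items observed in this phase and $m_0=|E|$; put $T(e)=1$ for all $e$. *Each later round $t$:* let $T_{t-1}(e)$ be the current counter and $\hat w_{T_{t-1}(e)}(e)$ the current estimate of $e$, put $U_t(e)=\hat w_{T_{t-1}(e)}(e)+\sqrt{2\log(t-1)/T_{t-1}(e)}$, let $\tilde M(t)\in\arg\max_{M\in\mathcal M} f(M,U_t)$ be the oracle's answer, put $\alpha_t=\frac{1}{\kappa m_0t^{\alpha}}$, and draw $M(t)$, given the past, from $$\pi_t(M)=(1-m_0\alpha_t)\mathbb I\{M=\tilde M(t)\}+\sum_{e\in E}\alpha_t\mathbb I\{M=M_e\};$$ then increase the counter of every $e\in M(t)$ by one and update its running average with $w_t(e)$. **Theorem.** (a) If $0\le\alpha<1$ and $\kappa\ge 1$,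 then for every $n$ $$\mathcal R_\nu(n,\pi)\le\sum_{e\in\tilde{\mathcal A}}\frac{712\,m}{\Delta_{e,\min}}\log n+5md+\frac{m\,n^{1-\alpha}}{\kappa(1-\alpha)}.$$ In particular, for $\kappa=2$, that is $\alpha_t=\frac1{2m_0t^\alpha}$, the last term is $\frac{mn^{1-\alpha}}{2(1-\alpha)}$. (b) (Large-gap property.) For all $\alpha\in[0,1]$ and $\delta>0$ there is a constant $C$, depending only on $\alpha$ and $\delta$, such that in every such problem with $\Delta_{e,\min}\ge\delta$ for all $e\in\tilde{\mathcal A}$, for every $\kappa\ge1$ and every $n$, $$\mathcal R_\nu(n,\pi)\le C\,(md\log n+m\,n^{1-\alpha}).$$ (Here $\log 0$ is read as $0$.) -/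

import Mathlib

open MeasureTheory ProbabilityTheory

noncomputable section

namespace MixComb

/-- Total weight `f(S, x) = ∑_{e ∈ S} x(e)`. -/
def f {d : ℕ} (S : Finset (Fin d)) (x : Fin d → ℝ) : ℝ := ∑ e ∈ S, x e

/-- Mean reward vector of the reward distribution `ν`. -/
def mean {d : ℕ} (ν : Measure (Fin d → ℝ)) (e : Fin d) : ℝ := ∫ x, x e ∂ν

/-- `Mstar` is an optimal super arm. -/
def IsOptimal {d : ℕ} (𝓜 : Finset (Finset (Fin d))) (ν : Measure (Fin d → ℝ))
    (Mstar : Finset (Fin d)) : Prop :=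
  Mstar ∈ 𝓜 ∧ ∀ S ∈ 𝓜, f S (mean ν) ≤ f Mstar (mean ν)

/-- The gap `Δ_S = f(M*, μ) - f(S, μ)`. -/
def gap {d : ℕ} (ν : Measure (Fin d → ℝ)) (Mstar S : Finset (Fin d)) : ℝ :=
  f Mstar (mean ν) - f S (mean ν)

open Classical in
/-- The items outside `M*` that lie in some suboptimal super arm, i.e. the items outside `M*` whose
minimum gap is defined. If every item is in some super arm and `M*` is the only optimal super arm,
then these are all items outside `M*`. -/
def subItems {d : ℕ} (𝓜 : Finset (Finset (Fin d))) (ν : Measure (Fin d → ℝ))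
    (Mstar : Finset (Fin d)) : Finset (Fin d) :=
  Finset.univ.filter fun e => e ∉ Mstar ∧ ∃ S ∈ 𝓜, e ∈ S ∧ 0 < gap ν Mstar S

/-- The minimum gap
`Δ_{e,min} = f(M*, μ) - max {f(S, μ) : S ∈ 𝓜, e ∈ S, Δ_S > 0}`. -/
def minGap {d : ℕ} (𝓜 : Finset (Finset (Fin d))) (ν : Measure (Fin d → ℝ))
    (Mstar : Finset (Fin d)) (e : Fin d) : ℝ :=
  f Mstar (mean ν) -
    sSup ((fun S => f S (mean ν)) '' {S | S ∈ 𝓜 ∧ e ∈ S ∧ 0 < gap ν Mstar S})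

/-- An exact optimization oracle: `O u` is a maximizer of `f(S, u)` over `S ∈ 𝓜`
(ties are broken in any measurable way). -/
structure IsOracle {d : ℕ} (𝓜 : Finset (Finset (Fin d)))
    (O : (Fin d → ℝ) → Finset (Fin d)) : Prop where
  mem : ∀ u, O u ∈ 𝓜
  le : ∀ u, ∀ S ∈ 𝓜, f S u ≤ f (O u) u
  measurable : ∀ S, MeasurableSet {u | O u = S}

/-! ### Initialization -/

/-- The binary vector `u`: zero at the items seen so far, one elsewhere. -/
def unseen {d : ℕ} (E : Finset (Fin d)) : Fin d → ℝ := fun e => if e ∈ E then 0 else 1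

/-- The items seen after `k` initialization rounds. -/
def seen {d : ℕ} (O : (Fin d → ℝ) → Finset (Fin d)) : ℕ → Finset (Fin d)
  | 0 => ∅
  | k + 1 => seen O k ∪ O (unseen (seen O k))

/-- The super arm played in initialization round `t = 1, 2, …`. -/
def initArm {d : ℕ} (O : (Fin d → ℝ) → Finset (Fin d)) (t : ℕ) : Finset (Fin d) :=
  O (unseen (seen O (t - 1)))

/-- The number of initialization rounds: the first time at which every item has been seen. -/
def initSteps {d : ℕ} (O : (Fin d → ℝ) → Finset (Fin d)) : ℕ :=
  sInf {k | seen O k = Finset.univ}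

/-- The super arm recorded for item `e` after `k` initialization rounds: the last one
that contains `e`. -/
def initRecord {d : ℕ} (O : (Fin d → ℝ) → Finset (Fin d)) : ℕ → Fin d → Finset (Fin d)
  | 0, _ => ∅
  | k + 1, e => if e ∈ initArm O (k + 1) then initArm O (k + 1) else initRecord O k e

/-- The set `E` of items observed in the initialization; its size is the number of recorded
pairs `(e, M_e)`. -/
def initItems {d : ℕ} (O : (Fin d → ℝ) → Finset (Fin d)) : Finset (Fin d) :=
  seen O (initSteps O)

/-- The super arm `M_e` returned by the initialization. -/
def recorded {d : ℕ} (O : (Fin d → ℝ) → Finset (Fin d)) (e : Fin d) : Finset (Fin d) :=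
  initRecord O (initSteps O) e

/-! ### Main loop. `M s` and `w s` are the super arm and the reward vector of round `s`. -/

/-- The observation counter `T_t(e)`. The initialization leaves it at one for each item it sees;
afterwards it grows by one with each observation. -/
def count {d : ℕ} (O : (Fin d → ℝ) → Finset (Fin d)) (M : ℕ → Finset (Fin d)) : ℕ → Fin d → ℕ
  | 0, _ => 0
  | t + 1, e =>
    if e ∈ M (t + 1) then
      if t + 1 ≤ initSteps O then 1 else count O M t e + 1
    else count O M t e

/-- The estimate `ŵ_{T_t(e)}(e)`. During the initialization the last observation overwrites earlier
ones; afterwards it is the running average. Only coordinates `e ∈ M s` of `w s` are used. -/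
def estimate {d : ℕ} (O : (Fin d → ℝ) → Finset (Fin d)) (M : ℕ → Finset (Fin d))
    (w : ℕ → Fin d → ℝ) : ℕ → Fin d → ℝ
  | 0, _ => 0
  | t + 1, e =>
    if e ∈ M (t + 1) then
      if t + 1 ≤ initSteps O then w (t + 1) e
      else ((count O M t e : ℝ) * estimate O M w t e + w (t + 1) e) / (count O M (t + 1) e : ℝ)
    else estimate O M w t e

/-- The index `U_t(e) = ŵ_{T_{t-1}(e)}(e) + √(2 log(t-1) / T_{t-1}(e))`. -/
def ucb {d : ℕ} (O : (Fin d → ℝ) → Finset (Fin d)) (M : ℕ → Finset (Fin d))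
    (w : ℕ → Fin d → ℝ) (t : ℕ) (e : Fin d) : ℝ :=
  estimate O M w (t - 1) e +
    Real.sqrt (2 * Real.log ((t : ℝ) - 1) / (count O M (t - 1) e : ℝ))

/-- The exploration weight `α_t = 1 / (κ m₀ t^α)` of each recorded super arm, so that
`1 / (κ t^α)` is the total exploration probability in round `t`. -/
def weight {d : ℕ} (O : (Fin d → ℝ) → Finset (Fin d)) (κ α : ℝ) (t : ℕ) : ℝ :=
  1 / (κ * ((initItems O).card : ℝ) * (t : ℝ) ^ α)

/-- The probability `π_t(S)` with which the algorithm plays `S` in round `t ≥ 1`, given the super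
arms and the observations of the rounds `1, …, t - 1`: in the initialization the prescribed super
arm, and afterwards `(1 - m₀ α_t) 𝟙{S = M̃(t)} + ∑_e α_t 𝟙{S = M_e}`, where `M̃(t)` maximizes
`f(·, U_t)`. -/
def policy {d : ℕ} (O : (Fin d → ℝ) → Finset (Fin d)) (κ α : ℝ) (t : ℕ)
    (M : ℕ → Finset (Fin d)) (w : ℕ → Fin d → ℝ) (S : Finset (Fin d)) : ℝ :=
  if t ≤ initSteps O then
    if S = initArm O t then 1 else 0
  else
    (1 - ((initItems O).card : ℝ) * weight O κ α t) * (if S = O (ucb O M w t) then 1 else 0) +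
      ∑ e ∈ initItems O, weight O κ α t * (if S = recorded O e then 1 else 0)

/-! ### The interaction with the environment -/

/-- The σ-algebra of the history `(M(1), w_1, …, M(t), w_t)`. -/
abbrev history {d : ℕ} {Ω : Type*} (w : ℕ → Ω → Fin d → ℝ) (M : ℕ → Ω → Finset (Fin d)) (t : ℕ) :
    MeasurableSpace Ω :=
  ⨆ s ∈ Set.Icc 1 t, (MeasurableSpace.comap (w s) inferInstance ⊔ MeasurableSpace.comap (M s) ⊤)

/-- `(M(t), w_t)_{t ≥ 1}` is a run of the algorithm on a stochastic semi-bandit with reward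
distribution `ν`: given the history, `M(t)` has the law `π_t`, and `w_t` has the law `ν` and is
independent of the history and of `M(t)`. -/
structure IsRun {d : ℕ} {Ω : Type*} [MeasurableSpace Ω] (P : Measure Ω)
    (ν : Measure (Fin d → ℝ)) (O : (Fin d → ℝ) → Finset (Fin d)) (κ α : ℝ)
    (w : ℕ → Ω → Fin d → ℝ) (M : ℕ → Ω → Finset (Fin d)) : Prop where
  measurable_reward : ∀ t, Measurable (w t)
  measurable_arm : ∀ t S, MeasurableSet (M t ⁻¹' {S})
  law : ∀ t, 1 ≤ t → P.map (w t) = ν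
  indep : ∀ t, 1 ≤ t → Indep (MeasurableSpace.comap (w t) inferInstance)
    (history w M (t - 1) ⊔ MeasurableSpace.comap (M t) ⊤) P
  select : ∀ t, 1 ≤ t → ∀ S,
    P⟦M t ⁻¹' {S} | history w M (t - 1)⟧ =ᵐ[P]
      fun ω => policy O κ α t (fun s => M s ω) (fun s => w s ω) S

/-- The regret `∑_{t=1}^n (E[f(M*, w_t)] - E[f(M(t), w_t)])`. -/
def regret {d : ℕ} {Ω : Type*} [MeasurableSpace Ω] (P : Measure Ω)
    (w : ℕ → Ω → Fin d → ℝ) (M : ℕ → Ω → Finset (Fin d)) (Mstar : Finset (Fin d)) (n : ℕ) : ℝ :=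
  ∑ t ∈ Finset.Icc 1 n, ((∫ ω, f Mstar (w t ω) ∂P) - ∫ ω, f (M t ω) (w t ω) ∂P)

/-- A semi-bandit problem: super arms of size at most `m` that cover all base arms, an exact oracle,
a reward distribution on `[0,1]^d`, and an optimal super arm. -/
structure IsProblem {d : ℕ} (m : ℕ) (𝓜 : Finset (Finset (Fin d)))
    (ν : Measure (Fin d → ℝ)) (O : (Fin d → ℝ) → Finset (Fin d)) (Mstar : Finset (Fin d)) :
    Prop where
  card_le : ∀ S ∈ 𝓜, S.card ≤ m
  cover : ∀ e, ∃ S ∈ 𝓜, e ∈ S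
  oracle : IsOracle 𝓜 O
  bounded : ∀ᵐ x ∂ν, ∀ e, x e ∈ Set.Icc (0 : ℝ) 1
  optimal : IsOptimal 𝓜 ν Mstar

end MixComb

end

/-!
The regret is the sum of the expected gaps `E[Δ_{M(t)}]`, and every gap is at most `m`.

* The initialization is deterministic and takes at most `d` rounds, since each of them sees a new
  item (`card_seen_ge`). It costs at most `m d`.
* After it, the played super arm differs from the oracle's answer `M̃(t)` with probability at most
  `1 / (κ t^α)` (`IsRun.measureReal_ne_greedy_le`); these rounds cost at most `(m / κ) ∑ t^(-α)`.
* With `S` the sum of the centred observations of an item and `T` their number, Hoeffding's lemma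
  makes `exp (l S - l² T / 8)` a supermartingale after the initialization
  (`IsRun.lintegral_expSupermart_le`), because the decision to observe an item is independent of
  the reward of the round. Markov's inequality for each value of `T` and a union bound show that
  the estimate of an item leaves its confidence interval in round `t` with probability at most
  `2 / (t - 1)³` (`IsRun.measureReal_bad_le`). These events cost at most `4 m d` in total.
* In the remaining rounds the oracle's answer `S` is played and all estimates are accurate, so
  that `Δ_S ≤ ∑ 2 r_e` over `e ∈ S \ M*`, where `r_e = √(2 log n / T(e))` (`gap_le_two_mul_sum`).
  Doubling this inequality and subtracting `Δ_S` gives `Δ_S ≤ ∑ (4 r_e - Δ_S / m)`. An item thus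
  has to be charged `4 r_e` only as long as `4 r_e > Δ_{e,min} / m`, that is, for
  `T(e) < 32 (m / Δ_{e,min})² log n` (`gap_le_sum_charge`). The counter grows whenever the charge is paid
  (`sum_count_le`), so the total charge of an item is a sum of `1 / √k` over these values of the
  counter, at most `64 m log n / Δ_{e,min}` (`sum_charge_le`). This is well below the constant `712`.

`IsRun.regret_le` adds these contributions up. Both parts of the theorem follow from it by
estimating `∑ t^(-α)`; for the second, the additive constant is absorbed into `log n` when
`n ≥ 2`.
-/

namespace MixComb

/-! ### The initialization phase -/

lemma subset_seen_succ {d : ℕ} (O : (Fin d → ℝ) → Finset (Fin d)) (k : ℕ) :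
    seen O k ⊆ seen O (k + 1) := Finset.subset_union_left

lemma f_unseen_pos_iff {d : ℕ} (E S : Finset (Fin d)) :
    0 < f S (unseen E) ↔ ∃ e ∈ S, e ∉ E := by
  unfold f
  rw [Finset.sum_pos_iff_of_nonneg (fun e _ => by unfold unseen; split_ifs <;> norm_num)]
  refine exists_congr fun e => and_congr_right fun _ => ?_
  unfold unseen
  split_ifs with h <;> simp [h]

/-- Each initialization round sees a new item as long as there is one. -/
lemma card_seen_ge {d : ℕ} {𝓜 : Finset (Finset (Fin d))} {O : (Fin d → ℝ) → Finset (Fin d)}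
    (hO : IsOracle 𝓜 O) (hcover : ∀ e, ∃ S ∈ 𝓜, e ∈ S) (k : ℕ) :
    seen O k = Finset.univ ∨ k ≤ (seen O k).card := by
  induction k with
  | zero => right; simp
  | succ k ih =>
    rcases ih with h | h
    · left
      exact Finset.univ_subset_iff.1 (h ▸ subset_seen_succ O k)
    · by_cases hu : seen O k = Finset.univ
      · left
        exact Finset.univ_subset_iff.1 (hu ▸ subset_seen_succ O k)
      right
      obtain ⟨e, he⟩ : ∃ e, e ∉ seen O k := by
        by_contra! hc
        exact hu (Finset.eq_univ_iff_forall.2 hc)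
      obtain ⟨S, hS, heS⟩ := hcover e
      have hpos := ((f_unseen_pos_iff (seen O k) S).2 ⟨e, heS, he⟩).trans_le (hO.le _ S hS)
      obtain ⟨e', he', hne⟩ := (f_unseen_pos_iff _ _).1 hpos
      have : seen O k ⊂ seen O (k + 1) :=
        Finset.ssubset_iff_subset_ne.2 ⟨subset_seen_succ O k, fun heq =>
          hne (heq ▸ Finset.mem_union_right _ he')⟩
      exact Nat.succ_le_of_lt (h.trans_lt (Finset.card_lt_card this))

lemma seen_eq_univ {d : ℕ} {𝓜 : Finset (Finset (Fin d))} {O : (Fin d → ℝ) → Finset (Fin d)}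
    (hO : IsOracle 𝓜 O) (hcover : ∀ e, ∃ S ∈ 𝓜, e ∈ S) : seen O d = Finset.univ := by
  rcases card_seen_ge hO hcover d with h | h
  · exact h
  · exact Finset.card_eq_iff_eq_univ _ |>.1 (le_antisymm (Finset.card_le_univ _) (by simpa using h))

lemma initSteps_le {d : ℕ} {𝓜 : Finset (Finset (Fin d))} {O : (Fin d → ℝ) → Finset (Fin d)}
    (hO : IsOracle 𝓜 O) (hcover : ∀ e, ∃ S ∈ 𝓜, e ∈ S) : initSteps O ≤ d :=
  Nat.sInf_le (seen_eq_univ hO hcover)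

lemma initItems_eq_univ {d : ℕ} {𝓜 : Finset (Finset (Fin d))} {O : (Fin d → ℝ) → Finset (Fin d)}
    (hO : IsOracle 𝓜 O) (hcover : ∀ e, ∃ S ∈ 𝓜, e ∈ S) : initItems O = Finset.univ :=
  Nat.sInf_mem (s := {k | seen O k = Finset.univ}) ⟨d, seen_eq_univ hO hcover⟩

lemma initSteps_pos {d : ℕ} {𝓜 : Finset (Finset (Fin d))} {O : (Fin d → ℝ) → Finset (Fin d)}
    (hO : IsOracle 𝓜 O) (hcover : ∀ e, ∃ S ∈ 𝓜, e ∈ S) (e : Fin d) : 0 < initSteps O := by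
  by_contra! h
  have h1 := initItems_eq_univ hO hcover
  rw [initItems, Nat.le_zero.1 h] at h1
  have h2 := Finset.mem_univ e
  rw [← h1] at h2
  exact Finset.notMem_empty e h2

/-! ### The observation counters -/

lemma one_le_count_succ {d : ℕ} {O : (Fin d → ℝ) → Finset (Fin d)} {M : ℕ → Finset (Fin d)} {t : ℕ}
    {e : Fin d} (h : 1 ≤ count O M t e) : 1 ≤ count O M (t + 1) e := by
  rw [count]
  split_ifs <;> omega

lemma count_le {d : ℕ} (O : (Fin d → ℝ) → Finset (Fin d)) (M : ℕ → Finset (Fin d)) (t : ℕ)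
    (e : Fin d) : count O M t e ≤ t := by
  induction t with
  | zero => simp [count]
  | succ t ih =>
    rw [count]
    split_ifs <;> omega

lemma one_le_count_of_mem_seen {d : ℕ} {O : (Fin d → ℝ) → Finset (Fin d)}
    {M : ℕ → Finset (Fin d)} (hM : ∀ s, 1 ≤ s → s ≤ initSteps O → M s = initArm O s) {e : Fin d}
    (k : ℕ) (hk : k ≤ initSteps O) (he : e ∈ seen O k) : 1 ≤ count O M k e := by
  induction k with
  | zero => simp [seen] at he
  | succ k ih =>
    rcases Finset.mem_union.1 he with h | h
    · exact one_le_count_succ (ih (by omega) h)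
    · have : e ∈ M (k + 1) := by
        rw [hM (k + 1) (by omega) hk]
        exact h
      rw [count]
      simp [this, hk]

/-- Every item has been observed once the initialization is over. -/
lemma one_le_count {d : ℕ} {𝓜 : Finset (Finset (Fin d))} {O : (Fin d → ℝ) → Finset (Fin d)}
    (hO : IsOracle 𝓜 O) (hcover : ∀ e, ∃ S ∈ 𝓜, e ∈ S) {M : ℕ → Finset (Fin d)}
    (hM : ∀ s, 1 ≤ s → s ≤ initSteps O → M s = initArm O s) (e : Fin d) {t : ℕ}
    (ht : initSteps O ≤ t) : 1 ≤ count O M t e := by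
  induction t, ht using Nat.le_induction with
  | base =>
    refine one_le_count_of_mem_seen hM _ le_rfl ?_
    change e ∈ initItems O
    rw [initItems_eq_univ hO hcover]
    exact Finset.mem_univ e
  | succ t _ ih => exact one_le_count_succ ih

/-- A nonnegative charge that depends only on the counter of `e` is paid at most once for each
value of the counter. -/
lemma sum_count_le {d : ℕ} (O : (Fin d → ℝ) → Finset (Fin d)) (M : ℕ → Finset (Fin d))
    (e : Fin d) (h : ℕ → ℝ) (hh : ∀ k, 0 ≤ h k) (t : ℕ) :
    (∑ s ∈ Finset.range t, if initSteps O < s + 1 ∧ e ∈ M (s + 1) then h (count O M s e) else 0) ≤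
      ∑ k ∈ Finset.range (count O M t e), h k := by
  induction t with
  | zero => simp [count]
  | succ t ih =>
    rw [Finset.sum_range_succ]
    by_cases he : e ∈ M (t + 1)
    · by_cases hi : initSteps O < t + 1
      · have : count O M (t + 1) e = count O M t e + 1 := by
          rw [count, if_pos he, if_neg (by omega)]
        rw [this, Finset.sum_range_succ, if_pos ⟨hi, he⟩]
        linarith
      · rw [if_neg (by tauto), add_zero, Finset.sum_eq_zero]
        · exact Finset.sum_nonneg fun k _ => hh k
        · intro s hs
          have := Finset.mem_range.1 hs
          rw [if_neg (by omega)]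
    · have : count O M (t + 1) e = count O M t e := by rw [count, if_neg he]
      rw [this, if_neg (by tauto)]
      linarith

lemma inv_sqrt_succ_le (k : ℕ) :
    1 / √((k : ℝ) + 1) ≤ 2 * √((k : ℝ) + 1) - 2 * √(k : ℝ) := by
  have h1 : 0 < √((k : ℝ) + 1) := Real.sqrt_pos.2 (by positivity)
  have h0 : 0 ≤ √(k : ℝ) := Real.sqrt_nonneg _
  have e1 : √((k : ℝ) + 1) ^ 2 = k + 1 := Real.sq_sqrt (by positivity)
  have e0 : √(k : ℝ) ^ 2 = k := Real.sq_sqrt (by positivity)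
  rw [div_le_iff₀ h1]
  nlinarith [sq_nonneg (√((k : ℝ) + 1) - √(k : ℝ))]

lemma sum_inv_sqrt_le (L : ℝ) (k : ℕ) :
    (∑ j ∈ Finset.range k, if (j : ℝ) ≤ L then 1 / √(j : ℝ) else 0) ≤ 2 * √L := by
  suffices h : ∀ k : ℕ, (∑ j ∈ Finset.range (k + 1), if (j : ℝ) ≤ L then 1 / √(j : ℝ) else 0) ≤
      2 * √(min (k : ℝ) L) by
    cases k with
    | zero => simp
    | succ k =>
      refine (h k).trans ?_
      gcongr
      exact min_le_right _ _
  intro k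
  induction k with
  | zero => simp
  | succ k ih =>
    rw [Finset.sum_range_succ]
    by_cases hk : ((k + 1 : ℕ) : ℝ) ≤ L
    · rw [if_pos hk, min_eq_left hk]
      push_cast at hk ⊢
      rw [min_eq_left (by linarith)] at ih
      linarith [inv_sqrt_succ_le k]
    · rw [if_neg hk, add_zero]
      refine ih.trans ?_
      gcongr
      simp

/-! ### Means and gaps -/

section gaps

variable {d m : ℕ} {𝓜 : Finset (Finset (Fin d))} {ν : Measure (Fin d → ℝ)}
  {O : (Fin d → ℝ) → Finset (Fin d)} {Mstar : Finset (Fin d)}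

lemma integrable_eval [IsProbabilityMeasure ν]
    (hb : ∀ᵐ x ∂ν, ∀ e, x e ∈ Set.Icc (0 : ℝ) 1) (e : Fin d) :
    Integrable (fun x : Fin d → ℝ => x e) ν :=
  Integrable.of_mem_Icc 0 1 (measurable_pi_apply e).aemeasurable (hb.mono fun _ h => h e)

lemma mean_nonneg (hb : ∀ᵐ x ∂ν, ∀ e, x e ∈ Set.Icc (0 : ℝ) 1) (e : Fin d) : 0 ≤ mean ν e :=
  integral_nonneg_of_ae (hb.mono fun _ h => (h e).1)

lemma mean_le_one [IsProbabilityMeasure ν]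
    (hb : ∀ᵐ x ∂ν, ∀ e, x e ∈ Set.Icc (0 : ℝ) 1) (e : Fin d) : mean ν e ≤ 1 := by
  have := integral_mono_ae (integrable_eval hb e) (integrable_const (1 : ℝ))
    (hb.mono fun _ h => (h e).2)
  simpa [mean] using this

lemma gap_le [IsProbabilityMeasure ν] (h : IsProblem m 𝓜 ν O Mstar) (S : Finset (Fin d)) :
    gap ν Mstar S ≤ m := by
  have h1 : f Mstar (mean ν) ≤ Mstar.card := by
    have := Finset.sum_le_card_nsmul Mstar (mean ν) 1 fun e _ => mean_le_one h.bounded e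
    simpa [f] using this
  have h2 : 0 ≤ f S (mean ν) := Finset.sum_nonneg fun e _ => mean_nonneg h.bounded e
  have h3 : (Mstar.card : ℝ) ≤ m := by exact_mod_cast h.card_le _ h.optimal.1
  unfold gap
  linarith

lemma minGap_le {e : Fin d} {S : Finset (Fin d)} (hS : S ∈ 𝓜) (he : e ∈ S)
    (hg : 0 < gap ν Mstar S) : minGap 𝓜 ν Mstar e ≤ gap ν Mstar S := by
  unfold minGap
  have : BddAbove ((fun S => f S (mean ν)) '' {S | S ∈ 𝓜 ∧ e ∈ S ∧ 0 < gap ν Mstar S}) :=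
    ((Finset.finite_toSet 𝓜).subset fun S hS => hS.1).image _ |>.bddAbove
  exact sub_le_sub_left (le_csSup this ⟨S, ⟨hS, he, hg⟩, rfl⟩) _

lemma minGap_pos {e : Fin d} (he : e ∈ subItems 𝓜 ν Mstar) : 0 < minGap 𝓜 ν Mstar e := by
  obtain ⟨-, S, hS, heS, hg⟩ := by simpa [subItems] using he
  have hfin : ((fun S => f S (mean ν)) '' {S | S ∈ 𝓜 ∧ e ∈ S ∧ 0 < gap ν Mstar S}).Finite :=
    ((Finset.finite_toSet 𝓜).subset fun S hS => hS.1).image _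
  have hne : {S | S ∈ 𝓜 ∧ e ∈ S ∧ 0 < gap ν Mstar S}.Nonempty := ⟨S, hS, heS, hg⟩
  obtain ⟨S', hS', h⟩ := (hne.image _).csSup_mem hfin
  unfold minGap
  rw [← h]
  exact hS'.2.2

/-! ### Confidence radii and charges -/

/-- If all estimates are within their confidence radii `r`, then the gap of a super arm that is
optimal for the upper confidence bounds is at most twice the total radius of its items outside
`Mstar`: the common items cancel. -/
lemma gap_le_two_mul_sum (u r : Fin d → ℝ) (S : Finset (Fin d))
    (hle : f Mstar (fun e => u e + r e) ≤ f S (fun e => u e + r e))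
    (hr : ∀ e, |u e - mean ν e| ≤ r e) :
    gap ν Mstar S ≤ ∑ e ∈ S \ Mstar, 2 * r e := by
  have key : ∀ x : Fin d → ℝ, f Mstar x - f S x = f (Mstar \ S) x - f (S \ Mstar) x := by
    intro x
    unfold f
    have h1 := Finset.sum_inter_add_sum_sdiff Mstar S x
    have h2 := Finset.sum_inter_add_sum_sdiff S Mstar x
    rw [Finset.inter_comm] at h2
    linarith
  unfold gap
  rw [key]
  have h1 := key (fun e => u e + r e)
  have h2 : f (Mstar \ S) (mean ν) ≤ f (Mstar \ S) (fun e => u e + r e) :=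
    Finset.sum_le_sum fun e _ => by have := abs_le.1 (hr e); linarith
  have h3 : f (S \ Mstar) (fun e => u e + r e) ≤
      f (S \ Mstar) (mean ν) + ∑ e ∈ S \ Mstar, 2 * r e := by
    unfold f
    rw [← Finset.sum_add_distrib]
    exact Finset.sum_le_sum fun e _ => by have := abs_le.1 (hr e); linarith
  linarith

/-- The amount charged to an item with minimum gap `g` when its counter is `k`, in a problem with
super arms of size at most `m` and horizon `n`: four confidence radii `√(2 log n / k)`, as long as
these amount to at least `g / m`. At `k = 0` the radius is read as `0`. -/
noncomputable def charge (m n : ℕ) (g : ℝ) (k : ℕ) : ℝ :=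
  if (k : ℝ) ≤ 32 * Real.log n * (m / g) ^ 2 then 4 * √(2 * Real.log n) * (1 / √(k : ℝ)) else 0

lemma charge_nonneg (m n : ℕ) (g : ℝ) (k : ℕ) : 0 ≤ charge m n g k := by
  unfold charge
  split_ifs <;> positivity

lemma sum_charge_le (m n : ℕ) {g : ℝ} (hg : 0 < g) (k : ℕ) :
    ∑ j ∈ Finset.range k, charge m n g j ≤ 64 * m / g * Real.log n := by
  have hl : 0 ≤ Real.log n := Real.log_natCast_nonneg n
  have h := mul_le_mul_of_nonneg_left
    (sum_inv_sqrt_le (32 * Real.log n * (m / g) ^ 2) k)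
    (show 0 ≤ 4 * √(2 * Real.log n) by positivity)
  rw [Finset.mul_sum] at h
  simp only [mul_ite, mul_zero] at h
  refine h.trans (le_of_eq ?_)
  have e1 : √(32 * Real.log n * (m / g) ^ 2) = √(16 * (2 * Real.log n)) * (m / g) := by
    rw [Real.sqrt_mul (by positivity), Real.sqrt_sq (by positivity)]
    ring_nf
  have e2 : √(16 * (2 * Real.log n)) = 4 * √(2 * Real.log n) := by
    rw [Real.sqrt_mul (by norm_num), show (16 : ℝ) = 4 ^ 2 by norm_num, Real.sqrt_sq (by norm_num)]
  have e3 : √(2 * Real.log n) * √(2 * Real.log n) = 2 * Real.log n :=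
    Real.mul_self_sqrt (by positivity)
  rw [e1, e2]
  linear_combination (32 * (m / g)) * e3

/-- The gap of a suboptimal super arm is at most the sum of the charges of its items outside
`Mstar`. From `Δ ≤ ∑ 2 r` follows `Δ ≤ ∑ 4 r - Δ ≤ ∑ (4 r - Δ / m)`, and the summands with
`4 r ≤ Δ / m` can be dropped. -/
lemma gap_le_sum_charge {S : Finset (Fin d)} (hS : S ∈ 𝓜) (hcard : S.card ≤ m) {n : ℕ}
    (T : Fin d → ℕ) (hT : ∀ e, 1 ≤ T e)
    (h : gap ν Mstar S ≤ ∑ e ∈ S \ Mstar, 2 * √(2 * Real.log n / T e)) :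
    gap ν Mstar S ≤ ∑ e ∈ subItems 𝓜 ν Mstar,
      if e ∈ S then charge m n (minGap 𝓜 ν Mstar e) (T e) else 0 := by
  have hnn : ∀ e ∈ subItems 𝓜 ν Mstar,
      0 ≤ if e ∈ S then charge m n (minGap 𝓜 ν Mstar e) (T e) else 0 := by
    intro e _
    split_ifs
    exacts [charge_nonneg _ _ _ _, le_rfl]
  rcases le_or_gt (gap ν Mstar S) 0 with hg | hg
  · exact hg.trans (Finset.sum_nonneg hnn)
  have hm : (0 : ℝ) < m := by
    have : S.Nonempty := by
      by_contra hne
      rw [Finset.not_nonempty_iff_eq_empty.1 hne] at h hg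
      simp at h
      linarith
    exact_mod_cast (Finset.card_pos.2 this).trans_le hcard
  have hsub : S \ Mstar ⊆ subItems 𝓜 ν Mstar := by
    intro e he
    obtain ⟨h1, h2⟩ := Finset.mem_sdiff.1 he
    simp only [subItems, Finset.mem_filter, Finset.mem_univ, true_and]
    exact ⟨h2, S, hS, h1, hg⟩
  have hcard' : ((S \ Mstar).card : ℝ) ≤ m := by
    exact_mod_cast (Finset.card_le_card Finset.sdiff_subset).trans hcard
  have hl : 0 ≤ Real.log n := Real.log_natCast_nonneg n
  calc gap ν Mstar S
      ≤ (∑ e ∈ S \ Mstar, 4 * √(2 * Real.log n / T e)) - gap ν Mstar S := by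
        have : ∑ e ∈ S \ Mstar, 4 * √(2 * Real.log n / T e) =
            2 * ∑ e ∈ S \ Mstar, 2 * √(2 * Real.log n / T e) := by
          rw [Finset.mul_sum]
          exact Finset.sum_congr rfl fun e _ => by ring
        linarith
    _ ≤ ∑ e ∈ S \ Mstar, (4 * √(2 * Real.log n / T e) - gap ν Mstar S / m) := by
        rw [Finset.sum_sub_distrib, Finset.sum_const, nsmul_eq_mul]
        have : ((S \ Mstar).card : ℝ) * (gap ν Mstar S / m) ≤ m * (gap ν Mstar S / m) := by gcongr
        rw [mul_div_cancel₀ _ hm.ne'] at this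
        linarith
    _ ≤ ∑ e ∈ S \ Mstar, if e ∈ S then charge m n (minGap 𝓜 ν Mstar e) (T e) else 0 := by
        refine Finset.sum_le_sum fun e he => ?_
        have heS := (Finset.mem_sdiff.1 he).1
        rw [if_pos heS]
        have hpos := minGap_pos (hsub he)
        have hle := minGap_le (ν := ν) (Mstar := Mstar) hS heS hg
        have hT' : (0 : ℝ) < T e := by exact_mod_cast hT e
        unfold charge
        split_ifs with hk
        · rw [Real.sqrt_div' _ hT'.le]
          have : 0 ≤ gap ν Mstar S / m := by positivity
          rw [mul_assoc, mul_one_div]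
          linarith
        · push Not at hk
          have h1 : √(2 * Real.log n / T e) ≤ minGap 𝓜 ν Mstar e / m / 4 := by
            refine Real.sqrt_le_iff.2 ⟨by positivity, ?_⟩
            rw [div_le_iff₀ hT']
            have h2 := mul_le_mul_of_nonneg_left hk.le
              (show 0 ≤ (minGap 𝓜 ν Mstar e / m / 4) ^ 2 by positivity)
            refine le_trans (le_of_eq ?_) h2
            field_simp
            ring
          have h3 : minGap 𝓜 ν Mstar e / m ≤ gap ν Mstar S / m := by gcongr
          linarith
    _ ≤ _ := Finset.sum_le_sum_of_subset_of_nonneg hsub fun e he _ => hnn e he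

end gaps

/-! ### The filtration of a run -/

section run

variable {d m : ℕ} {𝓜 : Finset (Finset (Fin d))} {ν : Measure (Fin d → ℝ)}
  {O : (Fin d → ℝ) → Finset (Fin d)} {Mstar : Finset (Fin d)} {κ α : ℝ}
  {Ω : Type*} {w : ℕ → Ω → Fin d → ℝ} {M : ℕ → Ω → Finset (Fin d)}

lemma le_history {s t : ℕ} (h1 : 1 ≤ s) (hs : s ≤ t) :
    MeasurableSpace.comap (w s) inferInstance ⊔ MeasurableSpace.comap (M s) ⊤ ≤ history w M t :=
  le_iSup₂ (f := fun s (_ : s ∈ Set.Icc 1 t) =>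
    MeasurableSpace.comap (w s) inferInstance ⊔ MeasurableSpace.comap (M s) ⊤) s ⟨h1, hs⟩

lemma history_mono {s t : ℕ} (hs : s ≤ t) : history w M s ≤ history w M t :=
  iSup₂_le fun _ hr => le_history hr.1 (hr.2.trans hs)

lemma measurableSet_mem_arm (t : ℕ) (e : Fin d) :
    MeasurableSet[MeasurableSpace.comap (M t) ⊤] {ω | e ∈ M t ω} :=
  ⟨{S | e ∈ S}, trivial, rfl⟩

lemma measurableSet_mem_arm_history (t : ℕ) (e : Fin d) :
    MeasurableSet[history w M (t + 1)] {ω | e ∈ M (t + 1) ω} :=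
  (le_sup_right.trans (le_history (by omega) le_rfl)) _ (measurableSet_mem_arm (t + 1) e)

lemma measurable_reward_history (t : ℕ) (e : Fin d) :
    Measurable[history w M (t + 1)] fun ω => w (t + 1) ω e := by
  have h : Measurable[MeasurableSpace.comap (w (t + 1)) inferInstance] fun ω => w (t + 1) ω e :=
    (measurable_pi_apply e).comp (comap_measurable (w (t + 1)))
  exact h.mono (le_sup_left.trans (le_history (by omega) le_rfl)) le_rfl

lemma measurable_count (t : ℕ) (e : Fin d) :
    Measurable[history w M t] fun ω => count O (fun s => M s ω) t e := by
  induction t with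
  | zero => exact measurable_const
  | succ t ih =>
    have ih' := ih.mono (history_mono (w := w) (M := M) (Nat.le_succ t)) le_rfl
    simp only [count]
    refine Measurable.ite (measurableSet_mem_arm_history t e) ?_ ih'
    split_ifs
    · exact measurable_const
    · exact ih'.add_const 1

lemma measurable_estimate (t : ℕ) (e : Fin d) :
    Measurable[history w M t] fun ω => estimate O (fun s => M s ω) (fun s => w s ω) t e := by
  induction t with
  | zero => exact measurable_const
  | succ t ih =>
    have ih' := ih.mono (history_mono (w := w) (M := M) (Nat.le_succ t)) le_rfl
    have hc : Measurable[history w M (t + 1)] fun ω => (count O (fun s => M s ω) t e : ℝ) :=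
      measurable_from_top.comp
        ((measurable_count t e).mono (history_mono (w := w) (M := M) (Nat.le_succ t)) le_rfl)
    have hc' : Measurable[history w M (t + 1)] fun ω =>
        (count O (fun s => M s ω) (t + 1) e : ℝ) :=
      measurable_from_top.comp (measurable_count (t + 1) e)
    have hw := measurable_reward_history (w := w) (M := M) t e
    simp only [estimate]
    refine Measurable.ite (measurableSet_mem_arm_history t e) ?_ ih'
    split_ifs
    · exact hw
    · exact ((hc.mul ih').add hw).div hc'

lemma measurable_ucb (t : ℕ) :
    Measurable[history w M (t - 1)] fun ω => ucb O (fun s => M s ω) (fun s => w s ω) t := by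
  refine (@measurable_pi_iff _ _ _ (history w M (t - 1)) _ _).2 fun e => ?_
  have hc : Measurable[history w M (t - 1)] fun ω => (count O (fun s => M s ω) (t - 1) e : ℝ) :=
    measurable_from_top.comp (measurable_count (t - 1) e)
  have he : Measurable[history w M (t - 1)] fun ω =>
      estimate O (fun s => M s ω) (fun s => w s ω) (t - 1) e := measurable_estimate (t - 1) e
  have hs : Measurable[history w M (t - 1)] fun ω =>
      √(2 * Real.log ((t : ℝ) - 1) / count O (fun s => M s ω) (t - 1) e) :=
    Real.continuous_sqrt.measurable.comp (measurable_const.div hc)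
  exact he.add hs

lemma measurableSet_greedy (hO : IsOracle 𝓜 O) (t : ℕ) (S : Finset (Fin d)) :
    MeasurableSet[history w M (t - 1)]
      {ω | O (ucb O (fun s => M s ω) (fun s => w s ω) t) = S} :=
  measurable_ucb t (hO.measurable S)

/-- The exponential process of item `e` at inverse temperature `l`: with `S` the sum of the centred
observations that enter the estimate and `T` their number, this is `exp (l S - l² T / 8)`. -/
noncomputable def expSupermart (ν : Measure (Fin d → ℝ)) (O : (Fin d → ℝ) → Finset (Fin d))
    (w : ℕ → Ω → Fin d → ℝ) (M : ℕ → Ω → Finset (Fin d)) (e : Fin d) (l : ℝ) (t : ℕ) (ω : Ω) :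
    ENNReal :=
  ENNReal.ofReal (Real.exp (count O (fun s => M s ω) t e *
    (l * (estimate O (fun s => M s ω) (fun s => w s ω) t e - mean ν e) - l ^ 2 / 8)))

lemma measurable_expSupermart (e : Fin d) (l : ℝ) (t : ℕ) :
    Measurable[history w M t] (expSupermart ν O w M e l t) := by
  have hc : Measurable[history w M t] fun ω => (count O (fun s => M s ω) t e : ℝ) :=
    measurable_from_top.comp (measurable_count t e)
  exact (hc.mul ((((measurable_estimate t e).sub_const _).const_mul l).sub_const
    _)).exp.ennreal_ofReal

variable [MeasurableSpace Ω] {P : Measure Ω}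

lemma IsRun.comap_arm_le (h : IsRun P ν O κ α w M) (t : ℕ) :
    MeasurableSpace.comap (M t) ⊤ ≤ (inferInstance : MeasurableSpace Ω) := by
  rintro _ ⟨A, -, rfl⟩
  rw [← Set.biUnion_preimage_singleton]
  exact MeasurableSet.biUnion (Set.to_countable A) fun S _ => h.measurable_arm t S

lemma IsRun.history_le (h : IsRun P ν O κ α w M) (t : ℕ) :
    history w M t ≤ (inferInstance : MeasurableSpace Ω) :=
  iSup₂_le fun s _ => sup_le (h.measurable_reward s).comap_le (h.comap_arm_le s)

lemma IsRun.measurableSet_mem (h : IsRun P ν O κ α w M) (t : ℕ) (e : Fin d) :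
    MeasurableSet {ω | e ∈ M t ω} :=
  h.comap_arm_le t _ (measurableSet_mem_arm t e)

lemma IsRun.ae_bounded (h : IsRun P ν O κ α w M) (hb : ∀ᵐ x ∂ν, ∀ e, x e ∈ Set.Icc (0 : ℝ) 1)
    {t : ℕ} (ht : 1 ≤ t) : ∀ᵐ ω ∂P, ∀ e, w t ω e ∈ Set.Icc (0 : ℝ) 1 := by
  rw [← h.law t ht] at hb
  exact ae_of_ae_map (h.measurable_reward t).aemeasurable hb

lemma IsRun.integral_reward (h : IsRun P ν O κ α w M) {t : ℕ} (ht : 1 ≤ t) (e : Fin d) :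
    ∫ ω, w t ω e ∂P = mean ν e := by
  rw [mean, ← h.law t ht, integral_map (h.measurable_reward t).aemeasurable
    (measurable_pi_apply e).aestronglyMeasurable]

variable [IsProbabilityMeasure P]

/-- The selection rule, integrated over an event of the past on which the policy is bounded
below. -/
lemma IsRun.measureReal_select_ge (h : IsRun P ν O κ α w M) {t : ℕ} (ht : 1 ≤ t)
    (S : Finset (Fin d)) {A : Set Ω} (hA : MeasurableSet[history w M (t - 1)] A) {c : ℝ}
    (hc : ∀ ω ∈ A, c ≤ policy O κ α t (fun s => M s ω) (fun s => w s ω) S) :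
    c * P.real A ≤ P.real (A ∩ M t ⁻¹' {S}) := by
  have hle := h.history_le (t - 1)
  have hAm : MeasurableSet A := hle _ hA
  have hm : MeasurableSet (M t ⁻¹' {S}) := h.measurable_arm t S
  have hint : Integrable ((M t ⁻¹' {S}).indicator fun _ => (1 : ℝ)) P :=
    (integrable_const 1).indicator hm
  have e1 := setIntegral_condExp hle hint hA
  have e2 : ∫ x in A, (M t ⁻¹' {S}).indicator (fun _ => (1 : ℝ)) x ∂P =
      P.real (A ∩ M t ⁻¹' {S}) := by
    rw [setIntegral_indicator hm]
    simp
  rw [← e2, ← e1]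
  have e3 : ∫ _ in A, c ∂P = c * P.real A := by simp [mul_comm]
  rw [← e3]
  refine setIntegral_mono_on_ae (integrable_const c).integrableOn integrable_condExp.integrableOn
    hAm ?_
  filter_upwards [h.select t ht S] with ω hω hωA
  exact (hc ω hωA).trans hω.ge

/-- The initialization rounds are deterministic, up to a null set. -/
lemma IsRun.ae_init (h : IsRun P ν O κ α w M) :
    ∀ᵐ ω ∂P, ∀ s, 1 ≤ s → s ≤ initSteps O → M s ω = initArm O s := by
  refine ae_all_iff.2 fun s => ?_
  by_cases hs : 1 ≤ s ∧ s ≤ initSteps O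
  swap
  · exact Filter.Eventually.of_forall fun ω h1 h2 => absurd ⟨h1, h2⟩ hs
  have key := h.measureReal_select_ge hs.1 (initArm O s) (A := Set.univ) MeasurableSet.univ (c := 1)
    fun ω _ => by simp [policy, hs.2]
  rw [Set.univ_inter, probReal_univ, mul_one] at key
  have h1 : P.real (M s ⁻¹' {initArm O s})ᶜ ≤ 0 := by
    rw [probReal_compl_eq_one_sub (h.measurable_arm s _)]
    linarith
  have h2 : P (M s ⁻¹' {initArm O s})ᶜ = 0 := by
    have := le_antisymm h1 measureReal_nonneg
    exact (measureReal_eq_zero_iff (measure_ne_top _ _)).1 this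
  filter_upwards [compl_mem_ae_iff.2 h2] with ω hω _ _
  simpa using hω

/-- After the initialization, the algorithm deviates from the oracle's answer with probability at
most the total exploration probability. -/
lemma IsRun.measureReal_ne_greedy_le (h : IsRun P ν O κ α w M) (hO : IsOracle 𝓜 O) (hκ : 1 ≤ κ)
    {t : ℕ} (ht : initSteps O < t) :
    P.real {ω | M t ω ≠ O (ucb O (fun s => M s ω) (fun s => w s ω) t)} ≤
      1 / (κ * (t : ℝ) ^ α) := by
  set G : Finset (Fin d) → Set Ω :=
    fun S => {ω | O (ucb O (fun s => M s ω) (fun s => w s ω) t) = S} with hG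
  have hGm : ∀ S, MeasurableSet (G S) := fun S => h.history_le _ _ (measurableSet_greedy hO t S)
  have ht0 : (0 : ℝ) < t := by exact_mod_cast (Nat.zero_le _).trans_lt ht
  have hta : 0 < (t : ℝ) ^ α := Real.rpow_pos_of_pos ht0 α
  set ε := 1 / (κ * (t : ℝ) ^ α) with hε
  have hw0 : 0 ≤ weight O κ α t := by unfold weight; positivity
  have hwε : ((initItems O).card : ℝ) * weight O κ α t ≤ ε := by
    unfold weight
    rcases Nat.eq_zero_or_pos (initItems O).card with h0 | h0
    · rw [h0]
      simp only [Nat.cast_zero, zero_mul]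
      positivity
    · have : (0 : ℝ) < (initItems O).card := by exact_mod_cast h0
      refine le_of_eq ?_
      rw [hε]
      field_simp
  have hsel : ∀ S, (1 - ε) * P.real (G S) ≤ P.real (G S ∩ M t ⁻¹' {S}) := by
    intro S
    refine h.measureReal_select_ge (by omega) S (measurableSet_greedy hO t S) ?_
    intro ω hω
    have hω' : S = O (ucb O (fun s => M s ω) (fun s => w s ω) t) := hω.symm
    rw [policy, if_neg (by omega), if_pos hω', mul_one]
    have : 0 ≤ ∑ e ∈ initItems O, weight O κ α t * (if S = recorded O e then 1 else 0) :=
      Finset.sum_nonneg fun e _ => by split_ifs <;> simp [hw0]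
    linarith
  have hdisj : Set.PairwiseDisjoint (↑(Finset.univ : Finset (Finset (Fin d)))) G := by
    intro S _ S' _ hne
    refine Set.disjoint_left.2 fun ω h1 h2 => hne ?_
    exact h1.symm.trans h2
  have hGuniv : ∑ S, P.real (G S) = 1 := by
    rw [← measureReal_biUnion_finset hdisj fun S _ => hGm S]
    have : (⋃ S ∈ (Finset.univ : Finset (Finset (Fin d))), G S) = Set.univ := by
      ext ω
      simp [hG]
    rw [this, probReal_univ]
  have hbad : P.real {ω | M t ω ≠ O (ucb O (fun s => M s ω) (fun s => w s ω) t)} ≤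
      ∑ S, P.real (G S \ M t ⁻¹' {S}) := by
    refine (measureReal_mono ?_ (measure_ne_top _ _)).trans
      (measureReal_biUnion_finset_le Finset.univ _)
    intro ω hω
    simpa [hG] using hω
  refine hbad.trans ?_
  calc ∑ S, P.real (G S \ M t ⁻¹' {S}) ≤ ∑ S, ε * P.real (G S) := by
        refine Finset.sum_le_sum fun S _ => ?_
        have h1 := measureReal_inter_add_sdiff (μ := P) (s := G S) (h.measurable_arm t S)
        linarith [hsel S]
    _ = ε := by rw [← Finset.mul_sum, hGuniv, mul_one]

/-! ### Concentration of the estimates -/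

/-- The exponential moment of a single centred reward, by Hoeffding's lemma. -/
lemma IsRun.lintegral_exp_reward_le (h : IsRun P ν O κ α w M)
    (hb : ∀ᵐ x ∂ν, ∀ e, x e ∈ Set.Icc (0 : ℝ) 1) {t : ℕ} (ht : 1 ≤ t) (e : Fin d) (l : ℝ) :
    ∫⁻ ω, ENNReal.ofReal (Real.exp (l * (w t ω e - mean ν e) - l ^ 2 / 8)) ∂P ≤ 1 := by
  have hsub := hasSubgaussianMGF_of_mem_Icc (μ := P) (X := fun ω => w t ω e)
    ((measurable_pi_apply e).comp (h.measurable_reward t)).aemeasurable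
    ((h.ae_bounded hb ht).mono fun ω hω => hω e)
  rw [h.integral_reward ht] at hsub
  have h1 := hsub.mgf_le l
  have h2 := hsub.integrable_exp_mul l
  simp only [Real.exp_sub]
  rw [← ofReal_integral_eq_lintegral_ofReal (h2.div_const _)
    (Filter.Eventually.of_forall fun ω => by positivity), integral_div]
  refine ENNReal.ofReal_le_one.2 ?_
  rw [div_le_one (Real.exp_pos _)]
  refine h1.trans (Real.exp_le_exp.2 (le_of_eq ?_))
  simp
  ring

/-- The exponential process has expectation at most one: it is reset in the initialization rounds,
which are deterministic, and is a supermartingale afterwards, because the decision to observe `e` is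
taken before the reward is drawn. -/
lemma IsRun.lintegral_expSupermart_le (h : IsRun P ν O κ α w M)
    (hb : ∀ᵐ x ∂ν, ∀ e, x e ∈ Set.Icc (0 : ℝ) 1) (e : Fin d) (l : ℝ) (t : ℕ) :
    ∫⁻ ω, expSupermart ν O w M e l t ω ∂P ≤ 1 := by
  induction t with
  | zero => simp [expSupermart, count]
  | succ t ih =>
    set Y : Ω → ENNReal :=
      fun ω => ENNReal.ofReal (Real.exp (l * (w (t + 1) ω e - mean ν e) - l ^ 2 / 8)) with hY
    have hY1 : ∫⁻ ω, Y ω ∂P ≤ 1 := h.lintegral_exp_reward_le hb (by omega) e l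
    by_cases hi : t + 1 ≤ initSteps O
    · by_cases he : e ∈ initArm O (t + 1)
      · refine le_trans (le_of_eq (lintegral_congr_ae ?_)) hY1
        filter_upwards [h.ae_init] with ω hω
        have : e ∈ M (t + 1) ω := by rwa [hω (t + 1) (by omega) hi]
        simp [expSupermart, count, estimate, this, hi, hY]
      · refine le_trans (le_of_eq (lintegral_congr_ae ?_)) ih
        filter_upwards [h.ae_init] with ω hω
        have : e ∉ M (t + 1) ω := by rwa [hω (t + 1) (by omega) hi]
        simp [expSupermart, count, estimate, this]
    · set A : Set Ω := {ω | e ∈ M (t + 1) ω} with hA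
      have hAm : MeasurableSet A := h.measurableSet_mem (t + 1) e
      set X := expSupermart ν O w M e l t with hX
      have hXm : Measurable X := (measurable_expSupermart e l t).mono (h.history_le t) le_rfl
      have hdecomp : ∀ ω, expSupermart ν O w M e l (t + 1) ω =
          Aᶜ.indicator X ω + A.indicator X ω * Y ω := by
        intro ω
        by_cases hω : e ∈ M (t + 1) ω
        · have h1 : ω ∈ A := hω
          simp only [Set.indicator, Set.mem_compl_iff, h1, not_true, if_false, if_true, zero_add]
          rw [hX, hY, expSupermart, expSupermart, ← ENNReal.ofReal_mul (Real.exp_pos _).le,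
            ← Real.exp_add]
          simp only [count, estimate, hω, hi, if_true, if_false]
          push_cast
          congr 2
          field_simp
          ring
        · have h1 : ω ∉ A := hω
          simp only [Set.indicator, Set.mem_compl_iff, h1, not_false_iff, if_false, if_true,
            zero_mul, add_zero]
          simp [hX, expSupermart, count, estimate, hω]
      have hYm : Measurable[MeasurableSpace.comap (w (t + 1)) inferInstance] Y := by
        have h1 : Measurable[MeasurableSpace.comap (w (t + 1)) inferInstance]
            fun ω => w (t + 1) ω e :=
          (measurable_pi_apply e).comp (comap_measurable (w (t + 1)))
        exact (((h1.sub_const _).const_mul l).sub_const _).exp.ennreal_ofReal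
      have hind := lintegral_mul_eq_lintegral_mul_lintegral_of_independent_measurableSpace
        (sup_le (h.history_le t) (h.comap_arm_le (t + 1)))
        (h.measurable_reward (t + 1)).comap_le (h.indep (t + 1) (by omega)).symm
        (((measurable_expSupermart (ν := ν) (O := O) e l t).mono le_sup_left le_rfl).indicator
          ((le_sup_right : _ ≤ history w M t ⊔ _) _ (measurableSet_mem_arm (M := M) (t + 1) e)))
        hYm
      calc ∫⁻ ω, expSupermart ν O w M e l (t + 1) ω ∂P
          = ∫⁻ ω, Aᶜ.indicator X ω ∂P + ∫⁻ ω, A.indicator X ω * Y ω ∂P := by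
            rw [← lintegral_add_left (hXm.indicator hAm.compl)]
            exact lintegral_congr hdecomp
        _ = ∫⁻ ω, Aᶜ.indicator X ω ∂P + (∫⁻ ω, A.indicator X ω ∂P) * ∫⁻ ω, Y ω ∂P := by
            rw [← hind]
        _ ≤ ∫⁻ ω, Aᶜ.indicator X ω ∂P + ∫⁻ ω, A.indicator X ω ∂P := by
            gcongr
            exact mul_le_of_le_one_right' hY1
        _ = ∫⁻ ω, X ω ∂P := by
            rw [lintegral_indicator hAm, lintegral_indicator hAm.compl, add_comm,
              lintegral_add_compl _ hAm]
        _ ≤ 1 := ih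

/-- Markov's inequality for the exponential process at a fixed value `k` of the counter. -/
lemma IsRun.measureReal_le_of_expSupermart (h : IsRun P ν O κ α w M)
    (hb : ∀ᵐ x ∂ν, ∀ e, x e ∈ Set.Icc (0 : ℝ) 1) (e : Fin d) (l x : ℝ) (t : ℕ) {A : Set Ω}
    (hA : ∀ ω ∈ A, x ≤ count O (fun s => M s ω) t e *
      (l * (estimate O (fun s => M s ω) (fun s => w s ω) t e - mean ν e) - l ^ 2 / 8)) :
    P.real A ≤ Real.exp (-x) := by
  have hXm : Measurable (expSupermart ν O w M e l t) :=
    (measurable_expSupermart e l t).mono (h.history_le t) le_rfl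
  have h1 := mul_meas_ge_le_lintegral (μ := P) hXm (ENNReal.ofReal (Real.exp x))
  have h2 : A ⊆ {ω | ENNReal.ofReal (Real.exp x) ≤ expSupermart ν O w M e l t ω} := fun ω hω =>
    ENNReal.ofReal_le_ofReal (Real.exp_le_exp.2 (hA ω hω))
  have h3 : ENNReal.ofReal (Real.exp x) * P A ≤ 1 :=
    ((mul_le_mul_right (measure_mono h2) _).trans h1).trans (h.lintegral_expSupermart_le hb e l t)
  have h4 := ENNReal.toReal_mono ENNReal.one_ne_top h3
  rw [ENNReal.toReal_mul, ENNReal.toReal_ofReal (Real.exp_pos _).le, ENNReal.toReal_one] at h4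
  rw [Real.exp_neg, ← one_div, le_div_iff₀ (Real.exp_pos _), mul_comm]
  exact h4

/-- Hoeffding's bound for the adaptively sampled estimate, by a union bound over the possible values
of the counter. -/
lemma IsRun.measureReal_bad_le (h : IsRun P ν O κ α w M) (hp : IsProblem m 𝓜 ν O Mstar) (e : Fin d)
    {t : ℕ} (ht : initSteps O ≤ t) :
    P.real {ω | √(2 * Real.log t / count O (fun s => M s ω) t e) <
      |estimate O (fun s => M s ω) (fun s => w s ω) t e - mean ν e|} ≤ 2 / (t : ℝ) ^ 3 := by
  have hb := hp.bounded
  have ht1 : 1 ≤ t := (initSteps_pos hp.oracle hp.cover e).trans_le ht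
  have ht0 : (0 : ℝ) < t := by exact_mod_cast ht1
  have hlog : 0 ≤ Real.log t := Real.log_natCast_nonneg t
  set B : ℕ → Set Ω := fun k => {ω | count O (fun s => M s ω) t e = k ∧ √(2 * Real.log t / k) <
      |estimate O (fun s => M s ω) (fun s => w s ω) t e - mean ν e|} with hB
  have hexp : Real.exp (-(4 * Real.log t)) = 1 / (t : ℝ) ^ 4 := by
    rw [Real.exp_neg, show 4 * Real.log t = Real.log ((t : ℝ) ^ 4) by rw [Real.log_pow]; norm_num,
      Real.exp_log (by positivity), one_div]
  have hBk : ∀ k ∈ Finset.Icc 1 t, P.real (B k) ≤ 2 / (t : ℝ) ^ 4 := by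
    intro k hk
    have hk0 : (0 : ℝ) < k := by exact_mod_cast (Finset.mem_Icc.1 hk).1
    set r := √(2 * Real.log t / k) with hr
    -- `l = ± 4 r` maximizes the exponent `k (l x - l² / 8)` at the deviation `|x| = r`, where it is
    -- `2 k r² = 4 log t`.
    have hr0 : 0 ≤ r := Real.sqrt_nonneg _
    have hr2 : k * r ^ 2 = 2 * Real.log t := by
      rw [hr, Real.sq_sqrt (by positivity)]
      field_simp
    have hU := h.measureReal_le_of_expSupermart hb e (4 * r) (4 * Real.log t) t
      (A := {ω | count O (fun s => M s ω) t e = k ∧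
        r < estimate O (fun s => M s ω) (fun s => w s ω) t e - mean ν e}) fun ω hω => by
          rw [hω.1]
          have := mul_le_mul_of_nonneg_left hω.2.le (show 0 ≤ 4 * k * r by positivity)
          nlinarith
    have hL := h.measureReal_le_of_expSupermart hb e (-(4 * r)) (4 * Real.log t) t
      (A := {ω | count O (fun s => M s ω) t e = k ∧
        r < -(estimate O (fun s => M s ω) (fun s => w s ω) t e - mean ν e)}) fun ω hω => by
          rw [hω.1]
          have := mul_le_mul_of_nonneg_left hω.2.le (show 0 ≤ 4 * k * r by positivity)
          nlinarith
    rw [hexp] at hU hL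
    have hsub : B k ⊆ {ω | count O (fun s => M s ω) t e = k ∧
        r < estimate O (fun s => M s ω) (fun s => w s ω) t e - mean ν e} ∪
        {ω | count O (fun s => M s ω) t e = k ∧
        r < -(estimate O (fun s => M s ω) (fun s => w s ω) t e - mean ν e)} := by
      rintro ω ⟨h1, h2⟩
      rcases lt_abs.1 h2 with h3 | h3
      exacts [Or.inl ⟨h1, h3⟩, Or.inr ⟨h1, h3⟩]
    refine (measureReal_mono hsub).trans ((measureReal_union_le _ _).trans ?_)
    refine (add_le_add hU hL).trans (le_of_eq ?_)
    ring
  have hle : P.real {ω | √(2 * Real.log t / count O (fun s => M s ω) t e) <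
      |estimate O (fun s => M s ω) (fun s => w s ω) t e - mean ν e|} ≤
      P.real (⋃ k ∈ Finset.Icc 1 t, B k) := by
    refine ENNReal.toReal_mono (measure_ne_top _ _) (measure_mono_ae ?_)
    filter_upwards [h.ae_init] with ω hω hbad
    have h1 := one_le_count hp.oracle hp.cover hω e ht
    have h2 := count_le O (fun s => M s ω) t e
    exact Set.mem_biUnion (x := count O (fun s => M s ω) t e)
      (Finset.mem_coe.2 (Finset.mem_Icc.2 ⟨h1, h2⟩)) ⟨rfl, hbad⟩
  refine hle.trans ((measureReal_biUnion_finset_le _ _).trans ((Finset.sum_le_sum hBk).trans ?_))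
  rw [Finset.sum_const, Nat.card_Icc, nsmul_eq_mul, Nat.add_sub_cancel]
  refine le_of_eq ?_
  field_simp

/-! ### The regret as a sum of expected gaps -/

/-- The regret is the sum of the expected gaps of the played super arms. -/
lemma IsRun.regret_eq [IsProbabilityMeasure ν] (h : IsRun P ν O κ α w M)
    (hb : ∀ᵐ x ∂ν, ∀ e, x e ∈ Set.Icc (0 : ℝ) 1) (n : ℕ) :
    regret P w M Mstar n = ∑ t ∈ Finset.range n, ∫ ω, gap ν Mstar (M (t + 1) ω) ∂P := by
  have hIcc : Finset.Icc 1 n = Finset.Ico (0 + 1) (n + 1) := by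
    ext t
    simp only [Finset.mem_Icc, Finset.mem_Ico]
    omega
  rw [Finset.range_eq_Ico, Finset.sum_Ico_add' (fun t => ∫ ω, gap ν Mstar (M t ω) ∂P), ← hIcc]
  refine Finset.sum_congr rfl fun t ht => ?_
  have ht1 := (Finset.mem_Icc.1 ht).1
  have hwi : ∀ e, Integrable (fun ω => w t ω e) P := fun e =>
    Integrable.of_mem_Icc 0 1 ((measurable_pi_apply e).comp (h.measurable_reward t)).aemeasurable
      ((h.ae_bounded hb ht1).mono fun ω hω => hω e)
  have hrw : ∀ (x : Ω → Fin d → ℝ) ω, f (M t ω) (x ω) =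
      ∑ e, {ω | e ∈ M t ω}.indicator (fun _ => (1 : ℝ)) ω * x ω e := by
    intro x ω
    simp [f, Set.indicator, Finset.sum_ite_mem]
  have hAi : ∀ e, Integrable ({ω | e ∈ M t ω}.indicator fun _ => (1 : ℝ)) P := fun e =>
    (integrable_const 1).indicator (h.measurableSet_mem t e)
  have hprod : ∀ e, Integrable
      (fun ω => {ω | e ∈ M t ω}.indicator (fun _ => (1 : ℝ)) ω * w t ω e) P := fun e => by
    refine ((hwi e).indicator (h.measurableSet_mem t e)).congr
      (Filter.Eventually.of_forall fun ω => ?_)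
    by_cases hω : e ∈ M t ω <;> simp [Set.indicator, hω]
  have hfM : ∫ ω, f (M t ω) (w t ω) ∂P = ∫ ω, f (M t ω) (mean ν) ∂P := by
    simp_rw [hrw (fun ω => w t ω), hrw (fun _ => mean ν)]
    rw [integral_finsetSum _ fun e _ => hprod e,
      integral_finsetSum _ fun e _ => (hAi e).mul_const _]
    refine Finset.sum_congr rfl fun e _ => ?_
    have hind : IndepFun ({ω | e ∈ M t ω}.indicator fun _ => (1 : ℝ)) (fun ω => w t ω e) P := by
      rw [IndepFun_iff_Indep]
      refine indep_of_indep_of_le_left (indep_of_indep_of_le_right (h.indep t ht1).symm ?_) ?_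
      · exact Measurable.comap_le ((measurable_pi_apply e).comp (comap_measurable (w t)))
      · exact Measurable.comap_le (measurable_const.indicator
          ((le_sup_right : _ ≤ history w M (t - 1) ⊔ _) _ (measurableSet_mem_arm (M := M) t e)))
    rw [hind.integral_fun_mul_eq_mul_integral (hAi e).aestronglyMeasurable
      (hwi e).aestronglyMeasurable, h.integral_reward ht1, integral_mul_const]
  have hstar : ∫ ω, f Mstar (w t ω) ∂P = f Mstar (mean ν) := by
    unfold f
    rw [integral_finsetSum _ fun e _ => hwi e]
    exact Finset.sum_congr rfl fun e _ => h.integral_reward ht1 e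
  unfold gap
  rw [hfM, hstar, integral_sub (integrable_const _)]
  · simp
  · simp_rw [hrw (fun _ => mean ν)]
    exact integrable_finsetSum _ fun e _ => (hAi e).mul_const _

end run

/-! ### The regret bound -/

lemma sum_inv_cube_le (n : ℕ) : ∑ s ∈ Finset.range n, 2 / (s : ℝ) ^ 3 ≤ 4 := by
  suffices h : ∀ n : ℕ, ∑ s ∈ Finset.range (n + 2), 2 / (s : ℝ) ^ 3 ≤ 4 - 2 / ((n : ℝ) + 1) by
    have h0 := h n
    have h1 : ∑ s ∈ Finset.range n, 2 / (s : ℝ) ^ 3 ≤ ∑ s ∈ Finset.range (n + 2), 2 / (s : ℝ) ^ 3 :=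
      Finset.sum_le_sum_of_subset_of_nonneg (Finset.range_mono (by omega))
        fun _ _ _ => by positivity
    have h2 : (0 : ℝ) ≤ 2 / (n + 1) := by positivity
    linarith
  intro n
  induction n with
  | zero => norm_num [Finset.sum_range_succ]
  | succ n ih =>
    rw [Finset.sum_range_succ]
    push_cast
    have h1 : 2 / ((n : ℝ) + 2) ^ 3 ≤ 2 / ((n : ℝ) + 1) - 2 / ((n : ℝ) + 1 + 1) := by
      rw [div_sub_div _ _ (by positivity) (by positivity),
        div_le_div_iff₀ (by positivity) (by positivity)]
      have : (0 : ℝ) ≤ n := Nat.cast_nonneg n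
      nlinarith [pow_nonneg this 2, pow_nonneg this 3]
    linarith

lemma sum_inv_rpow_le {α : ℝ} (h0 : 0 ≤ α) (h1 : α < 1) (n : ℕ) :
    ∑ s ∈ Finset.range n, 1 / ((s + 1 : ℕ) : ℝ) ^ α ≤ (n : ℝ) ^ (1 - α) / (1 - α) := by
  have h1' : 0 < 1 - α := by linarith
  induction n with
  | zero => simp [Real.zero_rpow h1'.ne']
  | succ n ih =>
    rw [Finset.sum_range_succ]
    have hn : (0 : ℝ) < ((n + 1 : ℕ) : ℝ) := by positivity
    set x : ℝ := ((n + 1 : ℕ) : ℝ) with hx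
    have hx1 : (1 : ℝ) ≤ x := by rw [hx]; push_cast; linarith [Nat.cast_nonneg (α := ℝ) n]
    have hnx : (n : ℝ) = x * (1 + -(1 / x)) := by
      rw [mul_add, mul_neg, mul_one_div_cancel hn.ne', hx]
      push_cast
      ring
    have hinv : 1 / x ≤ 1 := (div_le_one hn).2 hx1
    have hb : (1 + -(1 / x)) ^ (1 - α) ≤ 1 + (1 - α) * -(1 / x) :=
      rpow_one_add_le_one_add_mul_self (by linarith) h1'.le (by linarith)
    have hp : 0 ≤ x ^ (1 - α) := Real.rpow_nonneg hn.le _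
    have hstep : (n : ℝ) ^ (1 - α) ≤ x ^ (1 - α) - (1 - α) * (1 / x ^ α) := by
      rw [hnx, Real.mul_rpow hn.le (by linarith)]
      refine (mul_le_mul_of_nonneg_left hb hp).trans (le_of_eq ?_)
      rw [Real.rpow_sub hn, Real.rpow_one]
      field_simp
      ring
    have : (n : ℝ) ^ (1 - α) / (1 - α) ≤ (x ^ (1 - α) - (1 - α) * (1 / x ^ α)) / (1 - α) := by
      gcongr
    rw [sub_div, mul_div_cancel_left₀ _ h1'.ne'] at this
    linarith

lemma sum_inv_le (n : ℕ) :
    ∑ s ∈ Finset.range n, 1 / ((s + 1 : ℕ) : ℝ) ≤ 1 + Real.log n := by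
  have h := harmonic_le_one_add_log n
  simpa [harmonic] using h

section regret

variable {d m : ℕ} {𝓜 : Finset (Finset (Fin d))} {ν : Measure (Fin d → ℝ)}
  {O : (Fin d → ℝ) → Finset (Fin d)} {Mstar : Finset (Fin d)} {κ α : ℝ}
  {Ω : Type*} {w : ℕ → Ω → Fin d → ℝ} {M : ℕ → Ω → Finset (Fin d)} [MeasurableSpace Ω]
  {P : Measure Ω} [IsProbabilityMeasure P]

lemma IsRun.integrable_gap (h : IsRun P ν O κ α w M) (t : ℕ) :
    Integrable (fun ω => gap ν Mstar (M t ω)) P := by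
  have hm : Measurable (fun ω => gap ν Mstar (M t ω)) := by
    have : Measurable[MeasurableSpace.comap (M t) ⊤] (fun ω => gap ν Mstar (M t ω)) :=
      (measurable_from_top (f := gap ν Mstar)).comp (comap_measurable (M t))
    exact this.mono (h.comap_arm_le t) le_rfl
  obtain ⟨C, hC⟩ := (Set.finite_range fun S => ‖gap ν Mstar S‖).bddAbove
  exact Integrable.of_bound hm.aestronglyMeasurable C
    (Filter.Eventually.of_forall fun ω => hC ⟨M t ω, rfl⟩)

lemma IsRun.regret_le_mul [IsProbabilityMeasure ν] (h : IsRun P ν O κ α w M)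
    (hp : IsProblem m 𝓜 ν O Mstar) (n : ℕ) :
    regret P w M Mstar n ≤ n * m := by
  rw [h.regret_eq hp.bounded]
  have : ∀ t ∈ Finset.range n, ∫ ω, gap ν Mstar (M (t + 1) ω) ∂P ≤ m := fun t _ => by
    have := integral_mono (h.integrable_gap (Mstar := Mstar) (t + 1)) (integrable_const (m : ℝ))
      fun ω => gap_le hp _
    simpa using this
  simpa using Finset.sum_le_card_nsmul _ _ _ this

/-- The regret bound with the total exploration probability left as a sum. -/
theorem IsRun.regret_le [IsProbabilityMeasure ν] (h : IsRun P ν O κ α w M)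
    (hp : IsProblem m 𝓜 ν O Mstar) (hκ : 1 ≤ κ) (n : ℕ) :
    regret P w M Mstar n ≤
      (∑ e ∈ subItems 𝓜 ν Mstar, 64 * m / minGap 𝓜 ν Mstar e * Real.log n) + 5 * m * d +
        m / κ * ∑ s ∈ Finset.range n, 1 / ((s + 1 : ℕ) : ℝ) ^ α := by
  set G : ℕ → Ω → Finset (Fin d) := fun t ω => O (ucb O (fun s => M s ω) (fun s => w s ω) t) with hG
  set A : ℕ → Set Ω := fun s => {ω | M (s + 1) ω ≠ G (s + 1) ω} with hA
  set B : ℕ → Fin d → Set Ω := fun s e =>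
    {ω | √(2 * Real.log s / count O (fun s => M s ω) s e) <
      |estimate O (fun s => M s ω) (fun s => w s ω) s e - mean ν e|} with hB
  have hAm : ∀ s, MeasurableSet (A s) := by
    intro s
    have : A s = ⋃ S, ({ω | G (s + 1) ω = S} \ M (s + 1) ⁻¹' {S}) := by
      ext ω
      simp [hA]
    rw [this]
    exact MeasurableSet.iUnion fun S =>
      (h.history_le _ _ (measurableSet_greedy hp.oracle (s + 1) S)).diff (h.measurable_arm _ _)
  have hBm : ∀ s e, MeasurableSet (B s e) := by
    intro s e
    have hc : Measurable fun ω => (count O (fun s => M s ω) s e : ℝ) :=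
      measurable_from_top.comp ((measurable_count s e).mono (h.history_le s) le_rfl)
    have he : Measurable fun ω => estimate O (fun s => M s ω) (fun s => w s ω) s e :=
      (measurable_estimate s e).mono (h.history_le s) le_rfl
    exact measurableSet_lt (measurable_const.div hc).sqrt
      (continuous_abs.measurable.comp (he.sub_const _))
  set R : ℕ → Ω → ℝ := fun s ω => if s + 1 ≤ initSteps O then (m : ℝ) else
    m * (A s).indicator 1 ω + m * ∑ e, (B s e).indicator 1 ω with hR
  have hind : ∀ {E : Set Ω}, MeasurableSet E → Integrable (E.indicator (1 : Ω → ℝ)) P :=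
    fun hE => (integrable_const 1).indicator hE
  have hRi : ∀ s, Integrable (R s) P := by
    intro s
    simp only [hR]
    split_ifs
    · exact integrable_const _
    · exact ((hind (hAm s)).const_mul _).add
        ((integrable_finsetSum _ fun e _ => hind (hBm s e)).const_mul _)
  have hRint : ∀ s, ∫ ω, R s ω ∂P ≤ (if s ∈ Finset.range (initSteps O) then (m : ℝ) else 0) +
      m / κ * (1 / ((s + 1 : ℕ) : ℝ) ^ α) + m * d * (2 / (s : ℝ) ^ 3) := by
    intro s
    have hpos : 0 ≤ m / κ * (1 / ((s + 1 : ℕ) : ℝ) ^ α) := by positivity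
    have hpos' : 0 ≤ (m : ℝ) * d * (2 / (s : ℝ) ^ 3) := by positivity
    by_cases hs : s + 1 ≤ initSteps O
    · have : s ∈ Finset.range (initSteps O) := Finset.mem_range.2 hs
      simp only [hR, hs, this, if_true, integral_const, probReal_univ, one_smul]
      linarith
    · have : s ∉ Finset.range (initSteps O) := fun hc => hs (Finset.mem_range.1 hc)
      simp only [hR, hs, this, if_false, zero_add]
      rw [integral_add ((hind (hAm s)).const_mul _)
        ((integrable_finsetSum _ fun e _ => hind (hBm s e)).const_mul _), integral_const_mul,
        integral_const_mul, integral_finsetSum _ fun e _ => hind (hBm s e),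
        integral_indicator_one (hAm s)]
      simp_rw [integral_indicator_one (hBm s _)]
      have h1 : P.real (A s) ≤ 1 / (κ * ((s + 1 : ℕ) : ℝ) ^ α) :=
        h.measureReal_ne_greedy_le hp.oracle hκ (by omega)
      have h2 : ∑ e, P.real (B s e) ≤ d * (2 / (s : ℝ) ^ 3) := by
        have := Finset.sum_le_card_nsmul Finset.univ (fun e => P.real (B s e)) _ fun e _ =>
          h.measureReal_bad_le hp e (t := s) (by omega)
        simpa using this
      have h3 := mul_le_mul_of_nonneg_left h1 (Nat.cast_nonneg (α := ℝ) m)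
      have h4 := mul_le_mul_of_nonneg_left h2 (Nat.cast_nonneg (α := ℝ) m)
      have h5 : (m : ℝ) * (1 / (κ * ((s + 1 : ℕ) : ℝ) ^ α)) =
          m / κ * (1 / ((s + 1 : ℕ) : ℝ) ^ α) := by
        field_simp
      linarith
  -- The charges of all rounds are summed before taking expectations: their total is bounded on
  -- every sample path.
  have hpath : ∀ᵐ ω ∂P, ∑ s ∈ Finset.range n, gap ν Mstar (M (s + 1) ω) ≤
      (∑ s ∈ Finset.range n, R s ω) +
        ∑ e ∈ subItems 𝓜 ν Mstar, 64 * m / minGap 𝓜 ν Mstar e * Real.log n := by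
    filter_upwards [h.ae_init] with ω hω
    set T : ℕ → Fin d → ℕ := count O fun s => M s ω with hT
    have hround : ∀ s ∈ Finset.range n, gap ν Mstar (M (s + 1) ω) ≤ R s ω +
        ∑ e ∈ subItems 𝓜 ν Mstar, if initSteps O < s + 1 ∧ e ∈ M (s + 1) ω then
          charge m n (minGap 𝓜 ν Mstar e) (T s e) else 0 := by
      intro s hs
      have hsn : s < n := Finset.mem_range.1 hs
      have hnn : 0 ≤ ∑ e ∈ subItems 𝓜 ν Mstar, if initSteps O < s + 1 ∧ e ∈ M (s + 1) ω then
          charge m n (minGap 𝓜 ν Mstar e) (T s e) else 0 :=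
        Finset.sum_nonneg fun e _ => by
          split_ifs
          exacts [charge_nonneg _ _ _ _, le_rfl]
      have hgap := gap_le hp (M (s + 1) ω)
      have hm0 : (0 : ℝ) ≤ m := Nat.cast_nonneg m
      have hAB : ∀ E : Set Ω, 0 ≤ E.indicator (1 : Ω → ℝ) ω := fun E =>
        Set.indicator_nonneg (fun _ _ => zero_le_one) ω
      by_cases hi : s + 1 ≤ initSteps O
      · simp only [hR, hi, if_true]
        linarith
      have hRs : R s ω = m * (A s).indicator 1 ω + m * ∑ e, (B s e).indicator 1 ω := by
        simp only [hR, hi, if_false]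
      have hBs : 0 ≤ ∑ e, (B s e).indicator (1 : Ω → ℝ) ω := Finset.sum_nonneg fun e _ => hAB _
      by_cases hωA : ω ∈ A s
      · have : (A s).indicator (1 : Ω → ℝ) ω = 1 := by simp [hωA]
        rw [hRs, this]
        have := mul_nonneg hm0 hBs
        linarith
      by_cases hωB : ∃ e, ω ∈ B s e
      · obtain ⟨e, he⟩ := hωB
        have h1 : (B s e).indicator (1 : Ω → ℝ) ω = 1 := by simp [he]
        have h2 := Finset.single_le_sum (f := fun e => (B s e).indicator (1 : Ω → ℝ) ω)
          (fun e _ => hAB (B s e)) (Finset.mem_univ e)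
        have h3 := mul_le_mul_of_nonneg_left h2 hm0
        have h4 := mul_nonneg hm0 (hAB (A s))
        rw [h1] at h3
        rw [hRs]
        linarith
      have hMG : M (s + 1) ω = G (s + 1) ω := by
        by_contra hc
        exact hωA hc
      have hconf : ∀ e, |estimate O (fun s => M s ω) (fun s => w s ω) s e - mean ν e| ≤
          √(2 * Real.log s / T s e) := fun e => not_lt.1 fun hc => hωB ⟨e, hc⟩
      have hmem : M (s + 1) ω ∈ 𝓜 := hMG ▸ hp.oracle.mem _
      have hucb : ucb O (fun s => M s ω) (fun s => w s ω) (s + 1) = fun e =>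
          estimate O (fun s => M s ω) (fun s => w s ω) s e + √(2 * Real.log s / T s e) := by
        ext e
        simp [ucb, hT]
      have h1 : gap ν Mstar (M (s + 1) ω) ≤
          ∑ e ∈ M (s + 1) ω \ Mstar, 2 * √(2 * Real.log s / T s e) := by
        refine gap_le_two_mul_sum _ _ _ ?_ hconf
        rw [← hucb, hMG]
        exact hp.oracle.le _ _ hp.optimal.1
      have hlog : Real.log s ≤ Real.log n := by
        rcases Nat.eq_zero_or_pos s with h0 | h0
        · rw [h0]
          simpa using Real.log_natCast_nonneg n
        · exact Real.log_le_log (by exact_mod_cast h0) (by exact_mod_cast hsn.le)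
      have h2 : gap ν Mstar (M (s + 1) ω) ≤
          ∑ e ∈ M (s + 1) ω \ Mstar, 2 * √(2 * Real.log n / T s e) := by
        refine h1.trans (Finset.sum_le_sum fun e _ => ?_)
        gcongr
      have h3 := gap_le_sum_charge hmem (hp.card_le _ hmem) (T s)
        (fun e => one_le_count hp.oracle hp.cover hω e (by omega)) h2
      have h4 : initSteps O < s + 1 := by omega
      simp only [h4, true_and]
      have h5 := mul_nonneg hm0 hBs
      have h6 := mul_nonneg hm0 (hAB (A s))
      rw [hRs]
      linarith
    refine (Finset.sum_le_sum hround).trans ?_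
    rw [Finset.sum_add_distrib, Finset.sum_comm]
    gcongr with e he
    exact (sum_count_le O (fun s => M s ω) e _ (charge_nonneg _ _ _) n).trans
      (sum_charge_le m n (minGap_pos he) _)
  rw [h.regret_eq hp.bounded, ← integral_finsetSum _ fun s _ => h.integrable_gap (s + 1)]
  refine (integral_mono_ae (integrable_finsetSum _ fun s _ => h.integrable_gap (s + 1))
    ((integrable_finsetSum _ fun s _ => hRi s).add (integrable_const _)) hpath).trans ?_
  rw [integral_add' (integrable_finsetSum _ fun s _ => hRi s) (integrable_const _),
    integral_finsetSum _ fun s _ => hRi s, integral_const, probReal_univ, one_smul]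
  have hsum := Finset.sum_le_sum fun s (_ : s ∈ Finset.range n) => hRint s
  rw [Finset.sum_add_distrib, Finset.sum_add_distrib, ← Finset.mul_sum, ← Finset.mul_sum] at hsum
  have hinit : (∑ s ∈ Finset.range n, if s ∈ Finset.range (initSteps O) then (m : ℝ) else 0) ≤
      m * d := by
    rw [Finset.sum_ite_mem, Finset.sum_const, nsmul_eq_mul, mul_comm]
    have h1 : (Finset.range n ∩ Finset.range (initSteps O)).card ≤ d :=
      (Finset.card_le_card Finset.inter_subset_right).trans
        (by simpa using initSteps_le hp.oracle hp.cover)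
    gcongr
  have hcube := mul_le_mul_of_nonneg_left (sum_inv_cube_le n) (show 0 ≤ (m : ℝ) * d by positivity)
  linarith

end regret

end MixComb

theorem mainTheorem9 :
    (∀ (d m : ℕ) (𝓜 : Finset (Finset (Fin d)))
        (ν : MeasureTheory.Measure (Fin d → ℝ)) [MeasureTheory.IsProbabilityMeasure ν]
        (O : (Fin d → ℝ) → Finset (Fin d)) (Mstar : Finset (Fin d)) (κ α : ℝ)
        {Ω : Type*} [MeasurableSpace Ω]
        (P : MeasureTheory.Measure Ω) [MeasureTheory.IsProbabilityMeasure P]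
        (w : ℕ → Ω → Fin d → ℝ) (M : ℕ → Ω → Finset (Fin d)) (n : ℕ),
        MixComb.IsProblem m 𝓜 ν O Mstar → 1 ≤ κ → 0 ≤ α → α < 1 →
        MixComb.IsRun P ν O κ α w M →
        MixComb.regret P w M Mstar n ≤
          (∑ e ∈ MixComb.subItems 𝓜 ν Mstar,
              712 * (m : ℝ) / MixComb.minGap 𝓜 ν Mstar e * Real.log n)
            + 5 * (m : ℝ) * (d : ℝ) + (m : ℝ) * (n : ℝ) ^ (1 - α) / (κ * (1 - α))) ∧
    (∀ (α δ : ℝ), 0 ≤ α → α ≤ 1 → 0 < δ →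
      ∃ C : ℝ, ∀ (d m : ℕ) (𝓜 : Finset (Finset (Fin d)))
        (ν : MeasureTheory.Measure (Fin d → ℝ)) [MeasureTheory.IsProbabilityMeasure ν]
        (O : (Fin d → ℝ) → Finset (Fin d)) (Mstar : Finset (Fin d)) (κ : ℝ)
        {Ω : Type*} [MeasurableSpace Ω]
        (P : MeasureTheory.Measure Ω) [MeasureTheory.IsProbabilityMeasure P]
        (w : ℕ → Ω → Fin d → ℝ) (M : ℕ → Ω → Finset (Fin d)) (n : ℕ),
        MixComb.IsProblem m 𝓜 ν O Mstar → 1 ≤ κ →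
        MixComb.IsRun P ν O κ α w M →
        (∀ e ∈ MixComb.subItems 𝓜 ν Mstar, δ ≤ MixComb.minGap 𝓜 ν Mstar e) →
        MixComb.regret P w M Mstar n ≤
          C * ((m : ℝ) * (d : ℝ) * Real.log n + (m : ℝ) * (n : ℝ) ^ (1 - α))) := by
  refine ⟨?_, ?_⟩
  · intro d m 𝓜 ν _ O Mstar κ α Ω _ P _ w M n hp hκ hα0 hα1 h
    refine (h.regret_le hp hκ n).trans ?_
    have hlog : 0 ≤ Real.log n := Real.log_natCast_nonneg n
    have h1 : ∑ e ∈ MixComb.subItems 𝓜 ν Mstar,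
        64 * (m : ℝ) / MixComb.minGap 𝓜 ν Mstar e * Real.log n ≤
        ∑ e ∈ MixComb.subItems 𝓜 ν Mstar,
          712 * (m : ℝ) / MixComb.minGap 𝓜 ν Mstar e * Real.log n := by
      refine Finset.sum_le_sum fun e he => ?_
      have := MixComb.minGap_pos he
      gcongr
      norm_num
    have h2 : (m : ℝ) / κ * ∑ s ∈ Finset.range n, 1 / ((s + 1 : ℕ) : ℝ) ^ α ≤
        (m : ℝ) * (n : ℝ) ^ (1 - α) / (κ * (1 - α)) := by
      refine (mul_le_mul_of_nonneg_left (MixComb.sum_inv_rpow_le hα0 hα1 n)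
        (by positivity)).trans (le_of_eq ?_)
      rw [div_mul_div_comm]
    linarith
  · intro α δ hα0 hα1 hδ
    -- For `α = 1` the exploration sum is harmonic; its logarithm goes into the first term.
    obtain ⟨K, hK0, hK⟩ : ∃ K : ℝ, 0 ≤ K ∧ ∀ n : ℕ,
        ∑ s ∈ Finset.range n, 1 / ((s + 1 : ℕ) : ℝ) ^ α ≤
          Real.log n + K * (n : ℝ) ^ (1 - α) := by
      rcases hα1.lt_or_eq with h1 | h1
      · refine ⟨1 / (1 - α), by have := sub_pos.2 h1; positivity, fun n => ?_⟩
        have := MixComb.sum_inv_rpow_le hα0 h1 n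
        have := Real.log_natCast_nonneg n
        rw [one_div_mul_eq_div]
        linarith
      · refine ⟨1, zero_le_one, fun n => ?_⟩
        have := MixComb.sum_inv_le n
        simp only [h1, Real.rpow_one, sub_self, Real.rpow_zero]
        linarith
    refine ⟨64 / δ + 5 / Real.log 2 + 1 + K, ?_⟩
    intro d m 𝓜 ν _ O Mstar κ Ω _ P _ w M n hp hκ h hgap
    have hlog2 : 0 < Real.log 2 := Real.log_pos one_lt_two
    have hlog : 0 ≤ Real.log n := Real.log_natCast_nonneg n
    have hp0 : 0 ≤ (n : ℝ) ^ (1 - α) := Real.rpow_nonneg (Nat.cast_nonneg n) _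
    have hm0 : (0 : ℝ) ≤ m := Nat.cast_nonneg m
    have hC : 0 ≤ 64 / δ + 5 / Real.log 2 + 1 + K := by positivity
    have hfirst : 0 ≤ (m : ℝ) * (d : ℝ) * Real.log n := by positivity
    rcases Nat.eq_zero_or_pos d with hd | hd
    · subst hd
      rw [h.regret_eq hp.bounded]
      simp only [MixComb.gap, MixComb.f, Finset.sum_of_isEmpty, sub_self, integral_zero,
        Finset.sum_const_zero]
      positivity
    have hd1 : (1 : ℝ) ≤ d := by exact_mod_cast hd
    rcases Nat.lt_or_ge n 2 with hn | hn
    · -- In the first round the logarithm vanishes, but the regret is at most `m`.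
      refine (h.regret_le_mul hp n).trans ?_
      interval_cases n
      · simp only [Nat.cast_zero, zero_mul]
        positivity
      · simp only [Nat.cast_one, one_mul, Real.log_one, mul_zero, zero_add, Real.one_rpow, mul_one]
        have : 1 ≤ 64 / δ + 5 / Real.log 2 + 1 + K := by
          have h1 : 0 ≤ 64 / δ := by positivity
          have h2 : 0 ≤ 5 / Real.log 2 := by positivity
          linarith
        exact le_mul_of_one_le_left hm0 this
    have hlogn : Real.log 2 ≤ Real.log n := Real.log_le_log two_pos (by exact_mod_cast hn)
    have hsum : ∑ e ∈ MixComb.subItems 𝓜 ν Mstar,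
        64 * (m : ℝ) / MixComb.minGap 𝓜 ν Mstar e * Real.log n ≤
        64 / δ * (m * d * Real.log n) := by
      have h1 : ∀ e ∈ MixComb.subItems 𝓜 ν Mstar,
          64 * (m : ℝ) / MixComb.minGap 𝓜 ν Mstar e * Real.log n ≤
            64 * m / δ * Real.log n := fun e he => by
        have := hgap e he
        gcongr
      refine (Finset.sum_le_card_nsmul _ _ _ h1).trans ?_
      have h2 : ((MixComb.subItems 𝓜 ν Mstar).card : ℝ) ≤ d := by
        exact_mod_cast (Finset.card_le_univ _).trans_eq (Fintype.card_fin d)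
      rw [nsmul_eq_mul]
      calc ((MixComb.subItems 𝓜 ν Mstar).card : ℝ) * (64 * m / δ * Real.log n)
          ≤ d * (64 * m / δ * Real.log n) := by gcongr
        _ = 64 / δ * (m * d * Real.log n) := by ring
    have hconst : 5 * (m : ℝ) * d ≤ 5 / Real.log 2 * (m * d * Real.log n) := by
      have : 1 ≤ Real.log n / Real.log 2 := (one_le_div hlog2).2 hlogn
      calc 5 * (m : ℝ) * d ≤ 5 * m * d * (Real.log n / Real.log 2) :=
            le_mul_of_one_le_right (by positivity) this
        _ = 5 / Real.log 2 * (m * d * Real.log n) := by ring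
    have hexpl : (m : ℝ) / κ * ∑ s ∈ Finset.range n, 1 / ((s + 1 : ℕ) : ℝ) ^ α ≤
        m * d * Real.log n + K * (m * (n : ℝ) ^ (1 - α)) := by
      have h1 : (m : ℝ) / κ ≤ m := div_le_self hm0 hκ
      calc (m : ℝ) / κ * ∑ s ∈ Finset.range n, 1 / ((s + 1 : ℕ) : ℝ) ^ α
          ≤ m * (Real.log n + K * (n : ℝ) ^ (1 - α)) :=
            mul_le_mul h1 (hK n) (Finset.sum_nonneg fun _ _ => by positivity) hm0
        _ = m * 1 * Real.log n + K * (m * (n : ℝ) ^ (1 - α)) := by ring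
        _ ≤ m * d * Real.log n + K * (m * (n : ℝ) ^ (1 - α)) := by gcongr
    have hrest : 0 ≤ (64 / δ + 5 / Real.log 2 + 1) * (m * (n : ℝ) ^ (1 - α)) +
        K * (m * d * Real.log n) := by positivity
    refine (h.regret_le hp hκ n).trans ?_
    linarith
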